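/- Let $\mathbb{T}=\mathbb{R}/2\pi\mathbb{Z}$ with normalized Lebesgue measure, let $1\le p\le 2$, let $p'\in[2,\infty]$ be the conjugate exponent ($\frac1p+\frac1{p'}=1$), and let $f\in L^p(\mathbb{T})$ be complex-valued with Fourier coefficients $\widehat f(k)=\frac1{2\pi}\int_0^{2\pi} f(x)e^{-ikx}\,dx$, $k\in\mathbb{Z}$. (1) If for some $0<\alpha\le 2$ $$\|f(\cdot+t)+f(\cdot-t)-2f(\cdot)\|_{L^p(\mathbb{T})}=O(t^\alpha)\qquad (t\to0^+),$$ then $\sum_{k\in\mathbb{Z}}|\widehat f(k)|^\beta$ converges for every real $\beta$ with $\frac{p}{p+\alpha p-1}<\beta\le p'$ (for $p=1$, where $p'=\infty$, this means every finite $\beta>1/\alpha$). (2) If this condition holds for some $\alpha>1/p$, then the Fourier series $\sum_{k}\widehat f(k)e^{ikx}$ converges absolutely for every $x\in\mathbb{T}$, and its partial sums $\sum_{|k|\le N}\widehat f(k)e^{ikx}$ converge uniformly on $\mathbb{T}$ as $N\to\infty$ to a continuous function that is equal to $f$ almost everywhere. -/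

import Mathlib

open Filter Topology MeasureTheory Asymptotics
open scoped ENNReal

noncomputable section

/-- The circle `𝕋 = ℝ / 2πℤ`, i.e. the unit circle parametrised by the angle. -/
abbrev Torus : Type := AddCircle (2 * Real.pi)

instance fact_zero_lt_two_mul_pi : Fact (0 < 2 * Real.pi) := ⟨Real.two_pi_pos⟩

/-- The symmetric second difference `x ↦ f (x + t) + f (x - t) - 2 f x` of a function on `𝕋`. -/
def symmSecondDiff (f : Torus → ℂ) (t : ℝ) : Torus → ℂ :=
  fun x => f (x + (t : Torus)) + f (x - (t : Torus)) - 2 * f x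

/-- The Lipschitz condition `‖f(· + t) + f(· - t) - 2 f‖_p = O(t ^ α)` as `t → 0⁺`, where the
`L^p` norm is taken with respect to the normalised Haar measure of `𝕋`. -/
def SecondDiffLipschitz (p α : ℝ) (f : Torus → ℂ) : Prop :=
  (fun t : ℝ =>
      (eLpNorm (symmSecondDiff f t) (ENNReal.ofReal p) AddCircle.haarAddCircle).toReal)
    =O[𝓝[>] 0] (fun t : ℝ => t ^ α)

/-- The symmetric partial sum `∑_{|k| ≤ N} f̂(k) e^{ikx}` of the Fourier series of `f`. -/
def fourierPartialSum (f : Torus → ℂ) (N : ℕ) (x : Torus) : ℂ :=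
  ∑ k ∈ Finset.Icc (-(N : ℤ)) N, fourierCoeff f k * fourier k x

end

/-! The second difference with step `t` multiplies the `k`-th coefficient by `2 cos (kt) - 2`. For
`t = 2⁻ⁿ` and `|k| ≈ 2ⁿ` this factor is bounded away from `0`, so the coefficients in the `n`-th
dyadic block are dominated by those of a function of `L^p` norm `O(2^(-nα))`. The full
Hausdorff-Young inequality is not needed: the restricted weak form `sum_norm_fourierCoeff_le`
together with `sum_rpow_le_of_sum_le` bounds the block sum of `|f̂|^β` by a constant times `2^(n(1 -
β(α + 1 - 1/p)))` for `β < p'`, which is geometric in the stated range. The endpoint `β = p'`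
follows from a smaller exponent, as the coefficients are bounded. In (2), `α > 1/p` makes `β = 1`
admissible, and uniqueness of Fourier coefficients identifies the sum of the series with `f`. -/

section FourierCoefficients

variable {T : ℝ} [hT : Fact (0 < T)]

/-! ### Weak Hausdorff-Young inequality -/

theorem norm_fourierCoeff_le (f : AddCircle T → ℂ) (k : ℤ) :
    ‖fourierCoeff f k‖ ≤ ∫ x, ‖f x‖ ∂AddCircle.haarAddCircle := by
  refine (norm_integral_le_integral_norm _).trans_eq (integral_congr_ae (ae_of_all _ fun x => ?_))
  simp [Circle.norm_coe]

/-- Bessel's inequality combined with Cauchy-Schwarz. -/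
theorem sq_sum_norm_fourierCoeff_le {f : AddCircle T → ℂ}
    (hf : MemLp f 2 AddCircle.haarAddCircle) (S : Finset ℤ) :
    (∑ k ∈ S, ‖fourierCoeff f k‖) ^ 2 ≤
      S.card * ∫ x, ‖f x‖ ^ 2 ∂AddCircle.haarAddCircle := by
  refine sq_sum_le_card_mul_sum_sq.trans (mul_le_mul_of_nonneg_left ?_ (Nat.cast_nonneg _))
  have h := hasSum_sq_fourierCoeff hf.toLp
  rw [fourierCoeff_congr_ae hf.coeFn_toLp] at h
  refine (sum_le_hasSum S (fun _ _ => by positivity) h).trans_eq (integral_congr_ae ?_)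
  filter_upwards [hf.coeFn_toLp] with x hx
  rw [hx]

/-- The restricted weak form of the Hausdorff-Young inequality, proved by cutting `f` at the height
`M * |S| ^ (1 / p)`. -/
theorem sum_norm_fourierCoeff_le {p : ℝ} (hp1 : 1 ≤ p) (hp2 : p ≤ 2) {f : AddCircle T → ℂ}
    (hf : MemLp f (ENNReal.ofReal p) AddCircle.haarAddCircle) {M : ℝ} (hM : 0 < M)
    (hfM : ∫ x, ‖f x‖ ^ p ∂AddCircle.haarAddCircle ≤ M ^ p) (S : Finset ℤ) :
    ∑ k ∈ S, ‖fourierCoeff f k‖ ≤ 2 * M * (S.card : ℝ) ^ (1 / p) := by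
  have hp0 : 0 < p := by linarith
  rcases S.eq_empty_or_nonempty with rfl | hS
  · simp [hp0.ne']
  -- A strongly measurable representative makes the level set `E` measurable.
  wlog hmeas : StronglyMeasurable f generalizing f
  · obtain ⟨f₀, hf₀, hff₀⟩ := hf.aestronglyMeasurable
    rw [fourierCoeff_congr_ae hff₀]
    refine this (hf.ae_eq hff₀) ((integral_congr_ae ?_).trans_le hfM) hf₀
    filter_upwards [hff₀] with x hx
    rw [hx]
  set m : ℝ := (S.card : ℝ) with hm
  have hm0 : 0 < m := by simpa [hm] using hS.card_pos
  obtain ⟨A, hA0, hAp, hA⟩ : ∃ A : ℝ, 0 < A ∧ A ^ p = M ^ p * m ∧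
      2 * A ≤ 2 * M * m ^ (1 / p) := by
    refine ⟨M * m ^ (1 / p), by positivity, ?_, by rw [mul_assoc]⟩
    rw [Real.mul_rpow hM.le (by positivity), ← Real.rpow_mul hm0.le, one_div,
      inv_mul_cancel₀ hp0.ne', Real.rpow_one]
  have hint : Integrable (fun x => ‖f x‖ ^ p) AddCircle.haarAddCircle := by
    simpa [ENNReal.toReal_ofReal hp0.le] using
      hf.integrable_norm_rpow (by simpa using hp0) ENNReal.ofReal_ne_top
  set E : Set (AddCircle T) := {x | ‖f x‖ ≤ A}
  have hset : MeasurableSet E :=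
    measurableSet_le hmeas.norm.measurable measurable_const
  have hL1 : Integrable f AddCircle.haarAddCircle :=
    memLp_one_iff_integrable.1 (hf.mono_exponent (by simpa using hp1))
  set f₁ := E.indicator f
  set f₂ := Eᶜ.indicator f
  have h₁int : Integrable f₁ AddCircle.haarAddCircle := hL1.indicator hset
  have h₂int : Integrable f₂ AddCircle.haarAddCircle := hL1.indicator hset.compl
  have hsplit : f = f₁ + f₂ := (Set.indicator_self_add_compl _ f).symm
  have h₁b : ∀ x, ‖f₁ x‖ ^ 2 ≤ A ^ (2 - p) * ‖f x‖ ^ p := by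
    intro x
    by_cases hx : x ∈ E
    · have : f₁ x = f x := Set.indicator_of_mem hx f
      rw [this]
      rcases (norm_nonneg (f x)).eq_or_lt with h0 | h0
      · rw [← h0, Real.zero_rpow hp0.ne']; simp
      · rw [← Real.rpow_natCast, show ((2 : ℕ) : ℝ) = (2 - p) + p by push_cast; ring,
          Real.rpow_add h0]
        gcongr ?_ * _
        exact Real.rpow_le_rpow h0.le hx (by linarith)
    · have : f₁ x = 0 := Set.indicator_of_notMem hx f
      rw [this, norm_zero, zero_pow two_ne_zero]; positivity
  have h₂b : ∀ x, ‖f₂ x‖ ≤ A ^ (1 - p) * ‖f x‖ ^ p := by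
    intro x
    by_cases hx : x ∈ E
    · have : f₂ x = 0 := Set.indicator_of_notMem (Set.notMem_compl_iff.2 hx) f
      rw [this, norm_zero]; positivity
    · have : f₂ x = f x := Set.indicator_of_mem (Set.mem_compl hx) f
      rw [this]
      replace hx : A < ‖f x‖ := not_le.1 hx
      calc ‖f x‖ = ‖f x‖ ^ (1 - p) * ‖f x‖ ^ p := by
            rw [← Real.rpow_add (hA0.trans hx)]; simp
        _ ≤ A ^ (1 - p) * ‖f x‖ ^ p := by
            gcongr ?_ * _
            exact Real.rpow_le_rpow_of_nonpos hA0 hx.le (by linarith)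
  have h₁mem : MemLp f₁ 2 AddCircle.haarAddCircle := by
    refine MemLp.of_bound h₁int.aestronglyMeasurable A (ae_of_all _ fun x => ?_)
    by_cases hx : x ∈ E
    · rwa [show f₁ x = f x from Set.indicator_of_mem hx f]
    · rw [show f₁ x = 0 from Set.indicator_of_notMem hx f]; simpa using hA0.le
  -- The height `A` balances the two pieces: the `L²` bound for `f₁` and the `L¹` bound for `f₂`
  -- both come out as exactly `A`.
  have e1 : A ^ (2 - p) * M ^ p * m = A ^ 2 := by
    rw [mul_assoc, ← hAp, ← Real.rpow_add hA0, sub_add_cancel, Real.rpow_two]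
  have e2 : A ^ (1 - p) * M ^ p * m = A := by
    rw [mul_assoc, ← hAp, ← Real.rpow_add hA0, sub_add_cancel, Real.rpow_one]
  have b1 : ∑ k ∈ S, ‖fourierCoeff f₁ k‖ ≤ A := by
    refine (sq_le_sq₀ (by positivity) hA0.le).1 ?_
    rw [← e1]
    refine (sq_sum_norm_fourierCoeff_le h₁mem S).trans ?_
    rw [mul_comm]
    refine mul_le_mul_of_nonneg_right ?_ hm0.le
    calc ∫ x, ‖f₁ x‖ ^ 2 ∂AddCircle.haarAddCircle
        ≤ ∫ x, A ^ (2 - p) * ‖f x‖ ^ p ∂AddCircle.haarAddCircle :=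
          integral_mono_of_nonneg (ae_of_all _ fun _ => by positivity) (hint.const_mul _)
            (ae_of_all _ h₁b)
      _ ≤ A ^ (2 - p) * M ^ p := by rw [integral_const_mul]; gcongr
  have b2 : ∑ k ∈ S, ‖fourierCoeff f₂ k‖ ≤ A := by
    have : ∀ k ∈ S, ‖fourierCoeff f₂ k‖ ≤ A ^ (1 - p) * M ^ p := fun k _ =>
      calc ‖fourierCoeff f₂ k‖ ≤ ∫ x, ‖f₂ x‖ ∂AddCircle.haarAddCircle := norm_fourierCoeff_le _ _
        _ ≤ ∫ x, A ^ (1 - p) * ‖f x‖ ^ p ∂AddCircle.haarAddCircle :=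
          integral_mono_of_nonneg (ae_of_all _ fun _ => by positivity) (hint.const_mul _)
            (ae_of_all _ h₂b)
        _ ≤ A ^ (1 - p) * M ^ p := by rw [integral_const_mul]; gcongr
    refine (Finset.sum_le_card_nsmul _ _ _ this).trans_eq ?_
    rw [nsmul_eq_mul, mul_comm, e2]
  calc ∑ k ∈ S, ‖fourierCoeff f k‖ ≤ ∑ k ∈ S, (‖fourierCoeff f₁ k‖ + ‖fourierCoeff f₂ k‖) := by
        refine Finset.sum_le_sum fun k _ => ?_
        rw [hsplit, fourierCoeff.add h₁int h₂int]
        exact norm_add_le _ _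
    _ ≤ 2 * M * m ^ (1 / p) := by rw [Finset.sum_add_distrib]; linarith

/-! ### Uniqueness of Fourier coefficients -/

/-- The pairing of continuous functions with an integrable function. -/
noncomputable def integralPairing {h : AddCircle T → ℂ} (hh : Integrable h AddCircle.haarAddCircle) :
    C(AddCircle T, ℂ) →L[ℂ] ℂ :=
  have hint (φ : C(AddCircle T, ℂ)) : Integrable (fun x => φ x * h x) AddCircle.haarAddCircle :=
    hh.bdd_mul φ.continuous.aestronglyMeasurable (ae_of_all _ φ.norm_coe_le_norm)
  LinearMap.mkContinuous
    { toFun := fun φ => ∫ x, φ x * h x ∂AddCircle.haarAddCircle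
      map_add' := fun φ ψ => by
        rw [← integral_add (hint φ) (hint ψ)]
        simp [add_mul]
      map_smul' := fun c φ => by
        rw [RingHom.id_apply, smul_eq_mul, ← integral_const_mul]
        simp [mul_assoc] }
    (∫ x, ‖h x‖ ∂AddCircle.haarAddCircle) fun φ => by
      refine (norm_integral_le_integral_norm _).trans ?_
      rw [mul_comm, ← integral_const_mul]
      refine integral_mono_of_nonneg (ae_of_all _ fun _ => norm_nonneg _) (hh.norm.const_mul _)
        (ae_of_all _ fun x => ?_)
      simp only [norm_mul]
      gcongr
      exact φ.norm_coe_le_norm x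

theorem integralPairing_apply {h : AddCircle T → ℂ} (hh : Integrable h AddCircle.haarAddCircle)
    (φ : C(AddCircle T, ℂ)) :
    integralPairing hh φ = ∫ x, φ x * h x ∂AddCircle.haarAddCircle := rfl

/-- An integrable function with vanishing Fourier coefficients vanishes almost everywhere. -/
theorem ae_eq_zero_of_fourierCoeff_eq_zero {h : AddCircle T → ℂ}
    (hh : Integrable h AddCircle.haarAddCircle) (h0 : ∀ k, fourierCoeff h k = 0) :
    h =ᵐ[AddCircle.haarAddCircle] 0 := by
  have hpair : integralPairing hh = 0 := by
    refine ContinuousLinearMap.ext_on (s := Set.range (@fourier T)) ?_ ?_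
    · rw [Submodule.dense_iff_topologicalClosure_eq_top]
      exact span_fourier_closure_eq_top
    · rintro _ ⟨k, rfl⟩
      simpa [fourierCoeff, integralPairing_apply] using h0 (-k)
  refine ae_eq_zero_of_forall_setIntegral_isClosed_eq_zero hh fun s hs => ?_
  obtain ⟨u, -, hu0, hu⟩ := exists_seq_strictAnti_tendsto (0 : ℝ)
  have hlim := thickenedIndicator_tendsto_indicator_closure hu0 hu s
  rw [hs.closure_eq, tendsto_pi_nhds] at hlim
  rw [← integral_indicator hs.measurableSet]
  -- Continuous functions decreasing to the indicator of the closed set `s` carry the vanishing of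
  -- the pairing over to `∫ₛ h`.
  let φ : ℕ → C(AddCircle T, ℂ) := fun n =>
    ⟨fun x => ((thickenedIndicator (hu0 n) s x : ℝ) : ℂ), by fun_prop⟩
  have hφ : Tendsto (fun n => ∫ x, φ n x * h x ∂AddCircle.haarAddCircle) atTop
      (𝓝 (∫ x, s.indicator h x ∂AddCircle.haarAddCircle)) := by
    refine tendsto_integral_of_dominated_convergence (fun x => ‖h x‖)
      (fun n => (φ n).continuous.aestronglyMeasurable.mul hh.aestronglyMeasurable) hh.norm
      (fun n => ae_of_all _ fun x => ?_) (ae_of_all _ fun x => ?_)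
    · rw [norm_mul]
      refine mul_le_of_le_one_left (norm_nonneg _) ?_
      have : (thickenedIndicator (hu0 n) s x : ℝ) ≤ 1 :=
        NNReal.coe_le_coe.2 (thickenedIndicator_le_one (hu0 n) s x)
      simpa [φ] using this
    · have h1 : Tendsto (fun n => φ n x) atTop
          (𝓝 (((s.indicator (fun _ => (1 : NNReal)) x : NNReal) : ℝ) : ℂ)) :=
        (Complex.continuous_ofReal.tendsto _).comp (NNReal.tendsto_coe.2 (hlim x))
      convert h1.mul_const (h x) using 2
      by_cases hx : x ∈ s <;> simp [hx]
  refine tendsto_nhds_unique hφ ?_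
  have : ∀ n, ∫ x, φ n x * h x ∂AddCircle.haarAddCircle = 0 := fun n => by
    rw [← integralPairing_apply hh, hpair]; rfl
  simp [this]

/-- If the Fourier coefficients of an integrable function are absolutely summable, the function
agrees almost everywhere with the sum of its Fourier series. -/
theorem ae_eq_tsum_fourier {f : AddCircle T → ℂ} (hf : Integrable f AddCircle.haarAddCircle)
    (hs : Summable fun k => ‖fourierCoeff f k‖) :
    f =ᵐ[AddCircle.haarAddCircle] fun x => ∑' k, fourierCoeff f k * fourier k x := by
  have hsum : Summable fun k : ℤ => fourierCoeff f k • (fourier k : C(AddCircle T, ℂ)) :=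
    .of_norm (by simpa [norm_smul, fourier_norm] using hs)
  obtain ⟨g, hg⟩ := hsum
  have hgx : ∀ x, g x = ∑' k, fourierCoeff f k * fourier k x := fun x => by
    simpa using ((ContinuousMap.evalCLM ℂ x).hasSum hg).tsum_eq.symm
  have hgint : Integrable g AddCircle.haarAddCircle :=
    g.continuous.integrable_of_hasCompactSupport (HasCompactSupport.of_compactSpace _)
  -- Taking the `k`-th coefficient is a continuous functional on `C(AddCircle T, ℂ)`, so it may be
  -- applied to the series term by term.
  have hcoeff : ∀ k, fourierCoeff g k = fourierCoeff f k := fun k => by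
    have hk : Integrable (fourier (-k) : AddCircle T → ℂ) AddCircle.haarAddCircle :=
      (map_continuous _).integrable_of_hasCompactSupport (HasCompactSupport.of_compactSpace _)
    have hpair : ∀ φ : C(AddCircle T, ℂ), integralPairing hk φ = fourierCoeff φ k := fun φ => by
      simp [integralPairing_apply, fourierCoeff, mul_comm]
    have hterm : ∀ j : ℤ, integralPairing hk (fourierCoeff f j • fourier j) =
        if j = k then fourierCoeff f k else 0 := fun j => by
      rw [map_smul, hpair, fourierCoeff_fourier, smul_eq_mul, Pi.single_apply]
      by_cases hjk : j = k
      · simp [hjk]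
      · simp [hjk, Ne.symm hjk]
    have h := (integralPairing hk).hasSum hg
    simp only [hterm, hpair] at h
    exact h.unique (hasSum_ite_eq k _)
  have hdiff := ae_eq_zero_of_fourierCoeff_eq_zero (hf.sub hgint) fun k => by
    have : f - g = f + (-1 : ℂ) • (g : AddCircle T → ℂ) := by ext x; simp [sub_eq_add_neg]
    rw [this, fourierCoeff.add hf (hgint.smul _), Pi.add_apply, fourierCoeff.const_smul, hcoeff]
    simp
  filter_upwards [hdiff] with x hx
  rw [← hgx]
  exact sub_eq_zero.1 hx

end FourierCoefficients

/-! ### Power sums and dyadic blocks -/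

/-- If `∑_{k ∈ S} c k ≤ M |S| ^ (1 - s)` for all subsets of `B`, then the sum of `c ^ β` over `B` is
controlled by the extremal sequence `M j ^ (-s)`. -/
theorem sum_rpow_le_of_sum_le {ι : Type*} {c : ι → ℝ} (hc : ∀ k, 0 ≤ c k) {M s β : ℝ}
    (hM : 0 ≤ M) (hβ : 0 < β) (hs : 0 ≤ s) (hsβ : β * s < 1) (B : Finset ι)
    (h : ∀ S ⊆ B, ∑ k ∈ S, c k ≤ M * (S.card : ℝ) ^ (1 - s)) :
    ∑ k ∈ B, c k ^ β ≤ M ^ β / (1 - β * s) * (B.card : ℝ) ^ (1 - β * s) := by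
  classical
  have hd : 0 < 1 - β * s := by linarith
  induction hn : B.card generalizing B with
  | zero =>
    rw [Finset.card_eq_zero] at hn
    simp [hn, hd.ne']
  | succ n ih =>
    have hne : B.Nonempty := Finset.card_pos.1 (by omega)
    obtain ⟨a, ha, hmin⟩ := B.exists_min_image c hne
    have hN : (0 : ℝ) < n + 1 := by positivity
    -- The minimum is at most the average over `B`; removing it leaves the hypothesis intact on a
    -- smaller set.
    have hca : c a ≤ M * ((n : ℝ) + 1) ^ (-s) := by
      have h1 : ((n : ℝ) + 1) * c a ≤ M * ((n : ℝ) + 1) ^ (1 - s) := by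
        have h2 := B.card_nsmul_le_sum c (c a) hmin
        have h3 := h B subset_rfl
        rw [hn] at h2 h3
        push_cast [nsmul_eq_mul] at h2 h3
        exact h2.trans h3
      rw [sub_eq_add_neg, Real.rpow_add hN, Real.rpow_one] at h1
      nlinarith
    have hcaβ : c a ^ β ≤ M ^ β * ((n : ℝ) + 1) ^ (-(β * s)) := by
      refine (Real.rpow_le_rpow (hc a) hca hβ.le).trans_eq ?_
      rw [Real.mul_rpow hM (by positivity), ← Real.rpow_mul hN.le]
      ring_nf
    -- Bernoulli's inequality for an exponent in `(0, 1]`, at `-1/(n+1)`, makes the bounds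
    -- telescope.
    have hber : (n : ℝ) ^ (1 - β * s) + (1 - β * s) * ((n : ℝ) + 1) ^ (-(β * s)) ≤
        ((n : ℝ) + 1) ^ (1 - β * s) := by
      have h1 := rpow_one_add_le_one_add_mul_self (s := -((n : ℝ) + 1)⁻¹)
        (neg_le_neg (inv_le_one_of_one_le₀ (by linarith [n.cast_nonneg (α := ℝ)]))) hd.le
        (by nlinarith)
      have h2 : (n : ℝ) ^ (1 - β * s) =
          ((n : ℝ) + 1) ^ (1 - β * s) * (1 + -((n : ℝ) + 1)⁻¹) ^ (1 - β * s) := by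
        have h3 : 1 + -((n : ℝ) + 1)⁻¹ = n / (n + 1) := by field_simp; ring
        rw [h3, ← Real.mul_rpow hN.le (by positivity)]
        congr 1
        field_simp
      have h4 : ((n : ℝ) + 1) ^ (-(β * s)) = ((n : ℝ) + 1) ^ (1 - β * s) * ((n : ℝ) + 1)⁻¹ := by
        rw [sub_eq_add_neg, Real.rpow_add hN, Real.rpow_one]
        field_simp
      rw [h2, h4]
      nlinarith [Real.rpow_pos_of_pos hN (1 - β * s)]
    have hih := ih (B.erase a) (fun S hS => h S (hS.trans (B.erase_subset a)))
      (by rw [Finset.card_erase_of_mem ha, hn]; rfl)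
    rw [← Finset.add_sum_erase B _ ha]
    push_cast
    calc c a ^ β + ∑ k ∈ B.erase a, c k ^ β
        ≤ M ^ β * ((n : ℝ) + 1) ^ (-(β * s)) + M ^ β / (1 - β * s) * (n : ℝ) ^ (1 - β * s) :=
          add_le_add hcaβ hih
      _ = M ^ β / (1 - β * s) *
          ((n : ℝ) ^ (1 - β * s) + (1 - β * s) * ((n : ℝ) + 1) ^ (-(β * s))) := by
          field_simp; ring
      _ ≤ _ := by gcongr

/-- The integers `k` with `2 ^ n ≤ |k| < 2 ^ (n + 1)`, and also `0` when `n = 0`. -/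
noncomputable def dyadicBlock (n : ℕ) : Finset ℤ :=
  (Finset.Icc (-2 ^ (n + 1)) (2 ^ (n + 1))).filter fun k => Nat.log 2 k.natAbs = n

theorem mem_dyadicBlock {n : ℕ} {k : ℤ} : k ∈ dyadicBlock n ↔ Nat.log 2 k.natAbs = n := by
  simp only [dyadicBlock, Finset.mem_filter, Finset.mem_Icc, and_iff_right_iff_imp]
  rintro rfl
  have h := Nat.lt_pow_succ_log_self one_lt_two k.natAbs
  have : (k.natAbs : ℤ) < 2 ^ (Nat.log 2 k.natAbs + 1) := by exact_mod_cast h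
  omega

theorem card_dyadicBlock_le (n : ℕ) : (dyadicBlock n).card ≤ 5 * 2 ^ n := by
  refine (Finset.card_filter_le _ _).trans ?_
  rw [Int.card_Icc]
  have h : (1 : ℤ) ≤ 2 ^ n := one_le_pow₀ (by norm_num)
  zify
  rw [Int.toNat_of_nonneg (by rw [pow_succ]; linarith), pow_succ]
  linarith

theorem abs_mem_of_mem_dyadicBlock {n : ℕ} (hn : n ≠ 0) {k : ℤ} (hk : k ∈ dyadicBlock n) :
    (2 : ℝ) ^ n ≤ |(k : ℝ)| ∧ |(k : ℝ)| ≤ 2 * 2 ^ n := by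
  rw [mem_dyadicBlock, Nat.log_eq_iff (Or.inl hn)] at hk
  rw [← Int.cast_abs, Int.abs_eq_natAbs, Int.cast_natCast]
  refine ⟨by exact_mod_cast hk.1, ?_⟩
  have := hk.2.le
  rw [pow_succ, mul_comm] at this
  exact_mod_cast this

/-- The blocks partition `ℤ`. An eventual bound suffices, as the Lipschitz condition only speaks of
small `t`. -/
theorem summable_of_dyadicBlock {a : ℤ → ℝ} (ha : ∀ k, 0 ≤ a k) {b : ℕ → ℝ} (hb : Summable b)
    (hab : ∀ᶠ n in atTop, ∑ k ∈ dyadicBlock n, a k ≤ b n) : Summable a := by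
  rw [summable_partition ha (s := fun n => (dyadicBlock n : Set ℤ))]
  · refine ⟨fun n => Summable.of_finite, ?_⟩
    simp only [Finset.tsum_subtype']
    refine hb.of_norm_bounded_eventually_nat ?_
    filter_upwards [hab] with n hn
    rwa [Real.norm_of_nonneg (Finset.sum_nonneg fun k _ => ha k)]
  · intro k
    simp [mem_dyadicBlock]

/-! ### Second differences on the Fourier side -/

theorem fourier_add_fourier_neg (k : ℤ) (t : ℝ) :
    (fourier k (t : Torus) : ℂ) + fourier (-k) (t : Torus) = 2 * Real.cos (k * t) := by
  rw [fourier_coe_apply, fourier_coe_apply, Complex.ofReal_cos, Complex.two_cos]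
  have : (Real.pi : ℂ) ≠ 0 := by exact_mod_cast Real.pi_ne_zero
  congr 2 <;> push_cast <;> field_simp

theorem memLp_translate {f : Torus → ℂ} {q : ℝ≥0∞} (hf : MemLp f q AddCircle.haarAddCircle)
    (a : Torus) : MemLp (fun x => f (x + a)) q AddCircle.haarAddCircle :=
  hf.comp_measurePreserving (measurePreserving_add_right _ a)

theorem fourierCoeff_translate (f : Torus → ℂ) (a : Torus) (k : ℤ) :
    fourierCoeff (fun x => f (x + a)) k = fourier k a * fourierCoeff f k := by
  unfold fourierCoeff
  rw [← integral_add_right_eq_self (fun t => fourier (-k) t • f t) a, ← integral_const_mul]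
  refine integral_congr_ae (ae_of_all _ fun x => ?_)
  have h : (fourier k a : ℂ) * fourier (-k) a = 1 := by
    rw [← fourier_add]; simp
  have h2 : (fourier (-k) (x + a) : ℂ) = fourier (-k) x * fourier (-k) a := by
    simp [fourier_apply, AddCircle.toCircle_add]
  simp only [smul_eq_mul]
  rw [h2]
  linear_combination (-(fourier (-k) x : ℂ) * f (x + a)) * h

theorem symmSecondDiff_eq_add (f : Torus → ℂ) (t : ℝ) :
    symmSecondDiff f t =
      ((fun x => f (x + (t : Torus))) + fun x => f (x + -(t : Torus))) +
        fun x => (-2 : ℂ) * f x := by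
  ext x; simp [symmSecondDiff, sub_eq_add_neg]

theorem memLp_symmSecondDiff {f : Torus → ℂ} {q : ℝ≥0∞} (hf : MemLp f q AddCircle.haarAddCircle)
    (t : ℝ) : MemLp (symmSecondDiff f t) q AddCircle.haarAddCircle := by
  rw [symmSecondDiff_eq_add]
  exact ((memLp_translate hf _).add (memLp_translate hf _)).add (hf.const_mul (-2))

theorem fourierCoeff_symmSecondDiff {f : Torus → ℂ} (hf : Integrable f AddCircle.haarAddCircle)
    (t : ℝ) (k : ℤ) :
    fourierCoeff (symmSecondDiff f t) k = (2 * Real.cos (k * t) - 2 : ℝ) * fourierCoeff f k := by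
  have hi : ∀ a : Torus, Integrable (fun x => f (x + a)) AddCircle.haarAddCircle := fun a =>
    memLp_one_iff_integrable.1 (memLp_translate (memLp_one_iff_integrable.2 hf) a)
  have hneg : (fourier k (-(t : Torus)) : ℂ) = fourier (-k) (t : Torus) := by
    simp [fourier_apply]
  rw [symmSecondDiff_eq_add, fourierCoeff.add ((hi _).add (hi _)) (hf.const_mul _), fourierCoeff.add (hi _) (hi _),
    Pi.add_apply, Pi.add_apply, fourierCoeff_translate, fourierCoeff_translate,
    fourierCoeff.const_mul, hneg, ← add_mul, fourier_add_fourier_neg]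
  push_cast
  ring

theorem norm_fourierCoeff_le_symmSecondDiff {f : Torus → ℂ}
    (hf : Integrable f AddCircle.haarAddCircle) {n : ℕ} (hn : n ≠ 0) {k : ℤ}
    (hk : k ∈ dyadicBlock n) :
    ‖fourierCoeff f k‖ ≤ 9 / 8 * ‖fourierCoeff (symmSecondDiff f ((2 ^ n)⁻¹)) k‖ := by
  obtain ⟨h1, h2⟩ := abs_mem_of_mem_dyadicBlock hn hk
  -- Here `|k| 2⁻ⁿ` lies in `[1, 2] ⊆ [0, π]`, so the cosine is at most `cos 1 ≤ 5/9`; hence `2 - 2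
  -- cos ≥ 8/9`, the source of `9/8`.
  have hcos : Real.cos (k * (2 ^ n)⁻¹) ≤ 5 / 9 := by
    rw [← Real.cos_abs, abs_mul, abs_of_pos (show (0 : ℝ) < (2 ^ n)⁻¹ by positivity)]
    refine le_trans (Real.cos_le_cos_of_nonneg_of_le_pi zero_le_one ?_ ?_) Real.cos_one_le
    · rw [← div_eq_mul_inv, div_le_iff₀ (by positivity)]
      linarith [Real.pi_gt_three, pow_pos (zero_lt_two' ℝ) n,
        mul_lt_mul_of_pos_right Real.pi_gt_three (pow_pos (zero_lt_two' ℝ) n)]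
    · rwa [← div_eq_mul_inv, le_div_iff₀ (by positivity), one_mul]
  rw [fourierCoeff_symmSecondDiff hf, norm_mul, Complex.norm_real, Real.norm_eq_abs,
    abs_of_nonpos (by linarith)]
  nlinarith [norm_nonneg (fourierCoeff f k)]

/-- The Lipschitz condition bounds the sums of Fourier coefficients over subsets of dyadic
blocks. -/
theorem SecondDiffLipschitz.eventually_sum_norm_fourierCoeff_le {p α : ℝ} (hp1 : 1 ≤ p)
    (hp2 : p ≤ 2) {f : Torus → ℂ} (hf : MemLp f (ENNReal.ofReal p) AddCircle.haarAddCircle)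
    (h : SecondDiffLipschitz p α f) :
    ∃ C : ℝ, 0 < C ∧ ∀ᶠ n : ℕ in atTop, ∀ S ⊆ dyadicBlock n,
      ∑ k ∈ S, ‖fourierCoeff f k‖ ≤ C * (2 ^ n : ℝ) ^ (-α) * (S.card : ℝ) ^ (1 / p) := by
  have hp0 : 0 < p := by linarith
  obtain ⟨C, hC, hbound⟩ := h.exists_pos
  have hL1 : Integrable f AddCircle.haarAddCircle :=
    memLp_one_iff_integrable.1 (hf.mono_exponent (by simpa using hp1))
  have hlim : Tendsto (fun n : ℕ => ((2 : ℝ) ^ n)⁻¹) atTop (𝓝[>] 0) :=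
    tendsto_inv_atTop_nhdsGT_zero.comp (tendsto_pow_atTop_atTop_of_one_lt one_lt_two)
  refine ⟨9 / 4 * C, by positivity, ?_⟩
  filter_upwards [hlim.eventually hbound.bound, eventually_ne_atTop 0] with n hn hn0 S hS
  set g := symmSecondDiff f ((2 ^ n)⁻¹) with hg
  have hgmem : MemLp g (ENNReal.ofReal p) AddCircle.haarAddCircle := memLp_symmSecondDiff hf _
  have hpow : ((2 ^ n : ℝ)⁻¹) ^ α = (2 ^ n : ℝ) ^ (-α) := by
    rw [Real.inv_rpow (by positivity), Real.rpow_neg (by positivity)]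
  rw [hpow, Real.norm_of_nonneg ENNReal.toReal_nonneg, Real.norm_of_nonneg (by positivity),
    hgmem.eLpNorm_eq_integral_rpow_norm (by simpa using hp0) ENNReal.ofReal_ne_top,
    ENNReal.toReal_ofReal hp0.le, ENNReal.toReal_ofReal (by positivity)] at hn
  have hnorm : ∫ x, ‖g x‖ ^ p ∂AddCircle.haarAddCircle ≤ (C * (2 ^ n : ℝ) ^ (-α)) ^ p :=
    (Real.rpow_inv_le_iff_of_pos (integral_nonneg fun _ => by positivity) (by positivity) hp0).1 hn
  have hsum := sum_norm_fourierCoeff_le hp1 hp2 hgmem (by positivity) hnorm S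
  calc ∑ k ∈ S, ‖fourierCoeff f k‖ ≤ ∑ k ∈ S, 9 / 8 * ‖fourierCoeff g k‖ :=
        Finset.sum_le_sum fun k hk => norm_fourierCoeff_le_symmSecondDiff hL1 hn0 (hS hk)
    _ ≤ 9 / 8 * (2 * (C * (2 ^ n : ℝ) ^ (-α)) * (S.card : ℝ) ^ (1 / p)) := by
        rw [← Finset.mul_sum]; gcongr
    _ = _ := by ring

/-! ### Summability and the main theorem -/

theorem SecondDiffLipschitz.summable_norm_fourierCoeff_rpow_of_lt {p α β : ℝ} (hp1 : 1 ≤ p)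
    (hp2 : p ≤ 2) {f : Torus → ℂ} (hf : MemLp f (ENNReal.ofReal p) AddCircle.haarAddCircle)
    (h : SecondDiffLipschitz p α f) (hβ : 0 < β) (hβ1 : 1 < β * (α + (1 - 1 / p)))
    (hβ2 : β * (1 - 1 / p) < 1) :
    Summable fun k : ℤ => ‖fourierCoeff f k‖ ^ β := by
  obtain ⟨C, hC, hev⟩ := h.eventually_sum_norm_fourierCoeff_le hp1 hp2 hf
  set s := 1 - 1 / p with hs
  have hs0 : 0 ≤ s := by
    have : 1 / p ≤ 1 := (div_le_one (by linarith)).2 hp1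
    linarith
  have hd : 0 < 1 - β * s := by linarith
  set D := C ^ β / (1 - β * s) * 5 ^ (1 - β * s) with hD
  have hgeom : Summable fun n : ℕ => D * ((2 : ℝ) ^ (1 - β * (α + s))) ^ n :=
    (summable_geometric_of_lt_one (by positivity)
      (Real.rpow_lt_one_of_one_lt_of_neg one_lt_two (by linarith))).mul_left D
  refine summable_of_dyadicBlock (fun _ => by positivity) hgeom ?_
  filter_upwards [hev] with n hn
  have hpos : (0 : ℝ) < 2 ^ n := by positivity
  refine (sum_rpow_le_of_sum_le (M := C * (2 ^ n : ℝ) ^ (-α)) (fun _ => norm_nonneg _) (by positivity) hβ hs0 hβ2 _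
    fun S hS => (hn S hS).trans_eq (by rw [hs, sub_sub_cancel])).trans ?_
  have hcard : ((dyadicBlock n).card : ℝ) ≤ 5 * 2 ^ n := by exact_mod_cast card_dyadicBlock_le n
  calc (C * (2 ^ n : ℝ) ^ (-α)) ^ β / (1 - β * s) * ((dyadicBlock n).card : ℝ) ^ (1 - β * s)
      ≤ (C * (2 ^ n : ℝ) ^ (-α)) ^ β / (1 - β * s) * (5 * 2 ^ n) ^ (1 - β * s) := by gcongr
    _ = D * ((2 ^ n : ℝ) ^ (-α * β) * (2 ^ n : ℝ) ^ (1 - β * s)) := by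
        rw [Real.mul_rpow hC.le (by positivity), ← Real.rpow_mul hpos.le,
          Real.mul_rpow (by norm_num) hpos.le, hD]
        ring
    _ = D * ((2 : ℝ) ^ (1 - β * (α + s))) ^ n := by
        rw [← Real.rpow_add hpos, ← Real.rpow_natCast, ← Real.rpow_natCast,
          ← Real.rpow_mul zero_le_two, ← Real.rpow_mul zero_le_two]
        ring_nf

theorem SecondDiffLipschitz.summable_norm_fourierCoeff_rpow {p α β : ℝ} (hp1 : 1 ≤ p)
    (hp2 : p ≤ 2) {f : Torus → ℂ} (hf : MemLp f (ENNReal.ofReal p) AddCircle.haarAddCircle)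
    (h : SecondDiffLipschitz p α f) (hα : 0 < α)
    (hβ1 : 1 < β * (α + (1 - 1 / p))) (hβ2 : β * (1 - 1 / p) ≤ 1) :
    Summable fun k : ℤ => ‖fourierCoeff f k‖ ^ β := by
  set s := 1 - 1 / p with hs
  have hs0 : 0 ≤ s := by
    have : 1 / p ≤ 1 := (div_le_one (by linarith)).2 hp1
    linarith
  have hαs : 0 < α + s := by linarith
  -- Lowering `β` to `γ` makes the second condition strict; the spare factor `|f̂(k)|^(β - γ)` is
  -- bounded by a power of `‖f‖₁`.
  obtain ⟨γ, hγ1, hγ2⟩ := exists_between ((div_lt_iff₀ hαs).2 hβ1)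
  have hγ0 : 0 < γ := lt_trans (by positivity) hγ1
  have hγs : γ * s < 1 := by
    rcases hs0.eq_or_lt with h0 | h0
    · rw [← h0]; simp
    · exact (mul_lt_mul_of_pos_right hγ2 h0).trans_le hβ2
  have hsum := h.summable_norm_fourierCoeff_rpow_of_lt hp1 hp2 hf hγ0
    ((div_lt_iff₀ hαs).1 hγ1) hγs
  refine (hsum.mul_right ((∫ x, ‖f x‖ ∂AddCircle.haarAddCircle) ^ (β - γ))).of_nonneg_of_le
    (fun k => by positivity) fun k => ?_
  have hsplit : ‖fourierCoeff f k‖ ^ β =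
      ‖fourierCoeff f k‖ ^ γ * ‖fourierCoeff f k‖ ^ (β - γ) := by
    rw [← Real.rpow_add_of_nonneg (norm_nonneg _) hγ0.le (by linarith)]
    ring_nf
  rw [hsplit]
  exact mul_le_mul_of_nonneg_left (Real.rpow_le_rpow (norm_nonneg _) (norm_fourierCoeff_le f k)
    (sub_nonneg.2 hγ2.le)) (by positivity)

theorem tendsto_Icc_neg_atTop :
    Tendsto (fun N : ℕ => Finset.Icc (-(N : ℤ)) N) atTop atTop := by
  refine tendsto_atTop_finset_of_monotone (fun m n hmn => ?_) fun k => ⟨k.natAbs, ?_⟩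
  · exact Finset.Icc_subset_Icc (by omega) (by omega)
  · rw [Finset.mem_Icc]; omega

theorem mainTheorem11 (p : ℝ) (hp1 : 1 ≤ p) (hp2 : p ≤ 2)
    (p' : ℝ≥0∞) (hpp' : ENNReal.HolderConjugate (ENNReal.ofReal p) p')
    (f : Torus → ℂ) (hf : MemLp f (ENNReal.ofReal p) AddCircle.haarAddCircle) :
    (∀ α : ℝ, 0 < α → α ≤ 2 → SecondDiffLipschitz p α f →
      ∀ β : ℝ, p / (p + α * p - 1) < β → ENNReal.ofReal β ≤ p' →
        Summable (fun k : ℤ => ‖fourierCoeff f k‖ ^ β)) ∧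
    (∀ α : ℝ, 1 / p < α → SecondDiffLipschitz p α f →
      (∀ x : Torus, Summable (fun k : ℤ => ‖fourierCoeff f k * fourier k x‖)) ∧
      ∃ g : Torus → ℂ, Continuous g ∧ f =ᵐ[AddCircle.haarAddCircle] g ∧
        TendstoUniformly (fourierPartialSum f) g atTop) := by
  have hp0 : 0 < p := by linarith
  refine ⟨fun α hα _ h β hβ hβp' => ?_, fun α hα h => ?_⟩
  · have hden : 0 < p + α * p - 1 := by nlinarith [mul_pos hα hp0]
    have hβ0 : 0 < β := lt_trans (by positivity) hβ
    refine h.summable_norm_fourierCoeff_rpow hp1 hp2 hf hα ?_ ?_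
    · rw [div_lt_iff₀ hden] at hβ
      have : β * (α + (1 - 1 / p)) = β * (p + α * p - 1) / p := by field_simp; ring
      rwa [this, one_lt_div hp0]
    -- Passing to inverses in `ℝ≥0∞` covers `p' = ∞` without a case split.
    · have h1 : (1 : ℝ≥0∞) ≤ ENNReal.ofReal (p⁻¹ + β⁻¹) := by
        rw [ENNReal.ofReal_add (by positivity) (by positivity), ENNReal.ofReal_inv_of_pos hp0,
          ENNReal.ofReal_inv_of_pos hβ0, ← hpp'.inv_add_inv_eq_one]
        gcongr
      rw [ENNReal.one_le_ofReal] at h1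
      have h2 : β * (p⁻¹ + β⁻¹) = β * p⁻¹ + 1 := by field_simp
      have h3 := mul_le_mul_of_nonneg_left h1 hβ0.le
      rw [h2] at h3
      rw [one_div]
      linarith
  · have hsum : Summable fun k : ℤ => ‖fourierCoeff f k‖ := by
      have hp' : 0 < 1 / p := by positivity
      simpa using h.summable_norm_fourierCoeff_rpow (β := 1) hp1 hp2 hf (hp'.trans hα)
        (by linarith) (by linarith)
    have hnorm : ∀ (k : ℤ) (x : Torus), ‖fourierCoeff f k * fourier k x‖ = ‖fourierCoeff f k‖ :=
      fun k x => by simp [Circle.norm_coe]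
    refine ⟨fun x => by simpa only [hnorm] using hsum,
      fun x => ∑' k : ℤ, fourierCoeff f k * fourier k x, ?_, ?_, ?_⟩
    · exact continuous_tsum (fun k => by fun_prop) hsum fun k x => (hnorm k x).le
    · exact ae_eq_tsum_fourier
        (memLp_one_iff_integrable.1 (hf.mono_exponent (by simpa using hp1))) hsum
    · exact fun v hv => tendsto_Icc_neg_atTop.eventually
        (tendstoUniformly_tsum hsum (fun k x => (hnorm k x).le) v hv)
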